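/- Let $\mathcal X$ be a nonempty measurable space, $\mathcal Y$ and $\mathcal R$ finite nonempty sets, $\ell:\mathcal R\to\mathbb R_+^{\mathcal Y}$ a (discrete) target loss, $L:\mathbb R^d\to\mathbb R_+^{\mathcal Y}$ a polyhedral surrogate loss (for each $y$, $u\mapsto L(u)_y$ is a maximum of finitely many affine functions), and $\psi:\mathbb R^d\to\mathcal R$ a link. For a loss $f:R\to\mathbb R_+^{\mathcal Y}$, a probability distribution $\mathcal D$ on $\mathcal X\times\mathcal Y$ and a measurable $g:\mathcal X\to R$ let $$R_f(g;\mathcal D)=\mathbb E_{(X,Y)\sim\mathcal D}f(g(X))_Y-\inf_{g':\mathcal X\to R\text{ measurable}}\mathbb E_{(X,Y)\sim\mathcal D}f(g'(X))_Y\in[0,\infty],$$ and for $p\in\Delta_{\mathcal Y}$, $r\in R$ let $R_f(r,p)=\langle p,f(r)\rangle-\inf_{r'\in R}\langle p,f(r')\rangle$. Let $\Gamma(p)=\operatorname{argmin}_{u\in\mathbb R^d}\langle p,L(u)\rangle$, $\gamma(p)=\operatorname{argmin}_{r\in\mathcal R}\langle p,\ell(r)\rangle$ and $\Gamma_u=\{p\in\Delta_{\mathcal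 Y}: u\in\Gamma(p)\}$; let $d_\infty(u,A)=\inf_{a\in A}\|u-a\|_\infty$. The pair $(L,\psi)$ is *consistent* for $\ell$ if there is $\zeta:\mathbb R_+\to\mathbb R_+$, continuous at $0$ with $\zeta(0)=0$, such that $R_\ell(\psi\circ h;\mathcal D)\le\zeta(R_L(h;\mathcal D))$ for all $\mathcal D$ and all measurable $h:\mathcal X\to\mathbb R^d$ (with $\psi\circ h$ measurable and $R_L(h;\mathcal D)<\infty$). It is *calibrated* for $\ell$ if $\inf\{R_L(u,p):\psi(u)\notin\gamma(p)\}>0$ for all $p\in\Delta_{\mathcal Y}$ (with $\inf\emptyset=+\infty$). The link is *$\epsilon$-separated* if $d_\infty(u,\Gamma(p))>\epsilon$ for all $p\in\Delta_{\mathcal Y}$ and all $u$ with $\psi(u)\notin\gamma(p)$. Define - $C_\ell=\max_{r,r'\in\mathcal R,\,y\in\mathcal Y}\big(\ell(r)_y-\ell(r')_y\big)$; - $H_{L,p}$, the smallest $H\in[0,\infty]$ with $d_\infty(u,\Gamma(p))\le H\,R_L(u,p)$ for all $u\in\mathbb R^d$; - $H_L=\sup_{q\in\mathcal Q}H_{L,q}$,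 where $\mathcal Q$ is the set of all vertices (extreme points) of those level sets $\Gamma_u$, $u\in\mathbb R^d$, that are full-dimensional in $\Delta_{\mathcal Y}$; - $\epsilon_\psi=\sup\{\epsilon\ge0:\psi\text{ is }\epsilon\text{-separated}\}\in[0,\infty]$ (with $\sup\emptyset=0$). Then: 1. $\mathcal Q$ is nonempty and finite, and $H_L<\infty$ (so $H_L$ is a maximum). 2. If $(L,\psi)$ is calibrated for $\ell$, then $\epsilon_\psi>0$. 3. If $(L,\psi)$ is consistent for $\ell$, then $(L,\psi)$ is calibrated for $\ell$ (hence $\epsilon_\psi>0$), and for every probability distribution $\mathcal D$ on $\mathcal X\times\mathcal Y$ and every measurable $h:\mathcal X\to\mathbb R^d$ with $\psi\circ h$ measurable, $$R_\ell(\psi\circ h;\mathcal D)\le\frac{C_\ell H_L}{\epsilon_\psi}\,R_L(h;\mathcal D),$$ where $C_\ell H_L/\epsilon_\psi=0$ if $\epsilon_\psi=\infty$, and $0\cdot\infty=0$. -/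

import Mathlib

open scoped NNReal ENNReal
open MeasureTheory

namespace PolyhedralSurrogate

noncomputable section

/-! ### Losses, conditional regret, elicited property

A loss with report space `R` and label set `Y` is a function `f : R → Y → ℝ≥0`.  Conditional
distributions are the points of `stdSimplex ℝ Y`. -/

/-- The expected loss `⟨p, f(r)⟩`. -/
def expectedLoss {R Y : Type*} [Fintype Y] (f : R → Y → ℝ≥0) (r : R) (p : Y → ℝ) : ℝ :=
  ∑ y, p y * (f r y : ℝ)

/-- The Bayes risk `inf_r ⟨p, f(r)⟩`. -/
def bayesRisk {R Y : Type*} [Fintype Y] (f : R → Y → ℝ≥0) (p : Y → ℝ) : ℝ :=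
  ⨅ r, expectedLoss f r p

/-- The conditional regret `⟨p, f(r)⟩ - inf_{r'} ⟨p, f(r')⟩`. -/
def condRegret {R Y : Type*} [Fintype Y] (f : R → Y → ℝ≥0) (r : R) (p : Y → ℝ) : ℝ :=
  expectedLoss f r p - bayesRisk f p

/-- The property elicited by `f`: the set of minimizers of the expected loss. -/
def prop {R Y : Type*} [Fintype Y] (f : R → Y → ℝ≥0) (p : Y → ℝ) : Set R :=
  {r | ∀ r', expectedLoss f r p ≤ expectedLoss f r' p}

/-- The level set of the elicited property for the report `r`. -/
def levelSet {R Y : Type*} [Fintype Y] (f : R → Y → ℝ≥0) (r : R) : Set (Y → ℝ) :=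
  {p | p ∈ stdSimplex ℝ Y ∧ r ∈ prop f p}

/-! ### Risk and regret with respect to a data distribution -/

/-- The risk `E_{(X,Y) ∼ D} f(g(X))_Y`, a number in `[0, ∞]`. -/
def risk {X R Y : Type*} [MeasurableSpace X] [MeasurableSpace Y]
    (f : R → Y → ℝ≥0) (g : X → R) (D : Measure (X × Y)) : ℝ≥0∞ :=
  ∫⁻ z, (f (g z.1) z.2 : ℝ≥0∞) ∂D

/-- The regret of `g`: its risk minus the infimum of the risk over all measurable hypotheses. -/
def regret {X R Y : Type*} [MeasurableSpace X] [MeasurableSpace R] [MeasurableSpace Y]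
    (f : R → Y → ℝ≥0) (g : X → R) (D : Measure (X × Y)) : ℝ≥0∞ :=
  risk f g D - ⨅ (g' : X → R) (_ : Measurable g'), risk f g' D

/-- `(L, ψ)` guarantees the regret transfer `ζ` for `ℓ`, on the feature space `X`: the target
regret is at most `ζ` of the surrogate regret, for every data distribution and every measurable
hypothesis for which the target risk is the integral of a measurable function.  The function `ζ`
is defined on finite regrets only, so nothing is asked when the surrogate regret is infinite. -/
def GuaranteesTransfer (X : Type*) {R Y : Type*} [MeasurableSpace X] [MeasurableSpace R]
    [MeasurableSpace Y] {d : ℕ} (L : (Fin d → ℝ) → Y → ℝ≥0) (ψ : (Fin d → ℝ) → R)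
    (ℓ : R → Y → ℝ≥0) (ζ : ℝ≥0 → ℝ≥0) : Prop :=
  ∀ (D : Measure (X × Y)), IsProbabilityMeasure D →
    ∀ h : X → (Fin d → ℝ), Measurable h → Measurable (ψ ∘ h) →
      regret L h D ≠ ∞ → regret ℓ (ψ ∘ h) D ≤ (ζ (regret L h D).toNNReal : ℝ≥0∞)

/-- `(L, ψ)` is consistent for `ℓ`: it guarantees some regret transfer, that is, some `ζ` which is
continuous at `0` and vanishes there. -/
def Consistent (X : Type*) {R Y : Type*} [MeasurableSpace X] [MeasurableSpace R]
    [MeasurableSpace Y] {d : ℕ} (L : (Fin d → ℝ) → Y → ℝ≥0) (ψ : (Fin d → ℝ) → R)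
    (ℓ : R → Y → ℝ≥0) : Prop :=
  ∃ ζ : ℝ≥0 → ℝ≥0, ContinuousAt ζ 0 ∧ ζ 0 = 0 ∧ GuaranteesTransfer X L ψ ℓ ζ

/-- The set of conditional surrogate regrets of the reports which link to a suboptimal target
report for `p`. -/
def badRegrets {R Y : Type*} [Fintype Y] {d : ℕ} (L : (Fin d → ℝ) → Y → ℝ≥0)
    (ψ : (Fin d → ℝ) → R) (ℓ : R → Y → ℝ≥0) (p : Y → ℝ) : Set ℝ :=
  {b | ∃ u, ψ u ∉ prop ℓ p ∧ b = condRegret L u p}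

/-- `(L, ψ)` is calibrated for `ℓ`.  The infimum is taken in `EReal`, so that it is `+∞` if there
are no bad reports. -/
def Calibrated {R Y : Type*} [Fintype Y] {d : ℕ} (L : (Fin d → ℝ) → Y → ℝ≥0)
    (ψ : (Fin d → ℝ) → R) (ℓ : R → Y → ℝ≥0) : Prop :=
  ∀ p ∈ stdSimplex ℝ Y, 0 < ⨅ b ∈ badRegrets L ψ ℓ p, (b : EReal)

/-! ### Polyhedral losses -/

/-- A pointwise maximum of a finite nonempty set of affine functions `u ↦ ⟨a, u⟩ + c`. -/
def IsPolyhedral {d : ℕ} (f : (Fin d → ℝ) → ℝ) : Prop :=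
  ∃ (s : Finset ((Fin d → ℝ) × ℝ)) (hs : s.Nonempty),
    ∀ u, f u = s.sup' hs (fun t => t.1 ⬝ᵥ u + t.2)

/-- A surrogate loss is polyhedral if it is polyhedral for each label. -/
def IsPolyhedralLoss {Y : Type*} {d : ℕ} (L : (Fin d → ℝ) → Y → ℝ≥0) : Prop :=
  ∀ y, IsPolyhedral (fun u => (L u y : ℝ))

/-! ### The three constants

The norm of `Fin d → ℝ` is the maximum norm, so `Metric.infEDist` is the distance in that norm
(and it is `∞` for the empty set). -/

/-- The link `ψ` is `ε`-separated with respect to `L` and `ℓ`. -/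
def IsSeparated {R Y : Type*} [Fintype Y] {d : ℕ} (L : (Fin d → ℝ) → Y → ℝ≥0)
    (ψ : (Fin d → ℝ) → R) (ℓ : R → Y → ℝ≥0) (ε : ℝ≥0) : Prop :=
  ∀ p ∈ stdSimplex ℝ Y, ∀ u, ψ u ∉ prop ℓ p → (ε : ℝ≥0∞) < Metric.infEDist u (prop L p)

/-- The separation `ε_ψ` of the link: the supremum in `[0, ∞]` of all `ε` such that `ψ` is
`ε`-separated. -/
def linkSeparation {R Y : Type*} [Fintype Y] {d : ℕ} (L : (Fin d → ℝ) → Y → ℝ≥0)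
    (ψ : (Fin d → ℝ) → R) (ℓ : R → Y → ℝ≥0) : ℝ≥0∞ :=
  ⨆ (ε : ℝ≥0) (_ : IsSeparated L ψ ℓ ε), (ε : ℝ≥0∞)

/-- The constant `C_ℓ = max_{r, r', y} (ℓ(r)_y - ℓ(r')_y)` (a maximum for finite nonempty `R`
and `Y`). -/
def lossRange {R Y : Type*} (ℓ : R → Y → ℝ≥0) : ℝ :=
  ⨆ t : R × R × Y, ((ℓ t.1 t.2.2 : ℝ) - (ℓ t.2.1 t.2.2 : ℝ))

/-- The constant `H_{L,p}`: the smallest `H` in `[0, ∞]` such that the distance of every report `u`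
to the set of optimal reports for `p` is at most `H` times the conditional regret of `u`. -/
def hoffmanAt {Y : Type*} [Fintype Y] {d : ℕ} (L : (Fin d → ℝ) → Y → ℝ≥0) (p : Y → ℝ) : ℝ≥0∞ :=
  sInf {H : ℝ≥0∞ | ∀ u, Metric.infEDist u (prop L p) ≤ H * ENNReal.ofReal (condRegret L u p)}

/-- The set of all vertices of the full-dimensional level sets of the property elicited by `L`.
A level set is full-dimensional if it has the same affine span as the simplex. -/
def levelVertices {Y : Type*} [Fintype Y] {d : ℕ} (L : (Fin d → ℝ) → Y → ℝ≥0) : Set (Y → ℝ) :=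
  {q | ∃ u, affineSpan ℝ (levelSet L u) = affineSpan ℝ (stdSimplex ℝ Y) ∧
    q ∈ (levelSet L u).extremePoints ℝ}

/-- The constant `H_L`: the supremum of `H_{L,q}` over the vertices `q` of the full-dimensional
level sets. -/
def hoffman {Y : Type*} [Fintype Y] {d : ℕ} (L : (Fin d → ℝ) → Y → ℝ≥0) : ℝ≥0∞ :=
  ⨆ q ∈ levelVertices L, hoffmanAt L q

end

end PolyhedralSurrogate

namespace PolyhedralSurrogate

open Set Filter Topology

/-! ### Conditional risks and their minimizers -/

section Basic

variable {R Y : Type*} [Fintype Y] {f : R → Y → ℝ≥0}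

/-! Finiteness drives everything. Reports with the same active affine pieces form a face, there are
finitely many faces, and whether a report is optimal for `p` depends only on its face
(`exists_face_index`, `GrowthLE.mem_prop`). Hence a polyhedral expected loss attains its minimum and
grows linearly away from its minimizers (`exists_error_bound`), which makes each Hoffman constant
finite. Only finitely many level sets occur, each a polytope, and the full-dimensional ones cover
the simplex.

At a vertex `q`, a report with a suboptimal link lies at distance at least `ε_ψ` from the optimal
reports, so its surrogate regret is at least `ε_ψ / H_L`, while its target regret is at most `C_ℓ`.
This is the linear bound at vertices (`Calibrated.condRegret_le_of_vertex`). On the level set of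
`u₀`, calibration makes `ψ u₀` optimal for the target, so both conditional regrets are affine in the
distribution there and the bound extends to the convex hull of the vertices, hence to the simplex
(`Calibrated.condRegret_le`).

Disintegrating the data distribution and comparing with a measurable, pointwise optimal hypothesis
integrates this bound (`Calibrated.regret_le`). Conversely, testing consistency on distributions
with a single feature yields calibration (`Consistent.calibrated`). -/

theorem expectedLoss_nonneg {p : Y → ℝ} (hp : p ∈ stdSimplex ℝ Y) (f : R → Y → ℝ≥0) (r : R) :
    0 ≤ expectedLoss f r p :=
  Finset.sum_nonneg fun y _ => mul_nonneg (hp.1 y) (NNReal.coe_nonneg _)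

theorem bayesRisk_eq {p : Y → ℝ} {r : R} (hr : r ∈ prop f p) :
    bayesRisk f p = expectedLoss f r p := by
  have : Nonempty R := ⟨r⟩
  exact le_antisymm (ciInf_le ⟨_, by rintro _ ⟨r', rfl⟩; exact hr r'⟩ r) (le_ciInf hr)

theorem condRegret_eq {p : Y → ℝ} {r₀ : R} (h : r₀ ∈ prop f p) (r : R) :
    condRegret f r p = expectedLoss f r p - expectedLoss f r₀ p := by
  rw [condRegret, bayesRisk_eq h]

theorem condRegret_nonneg {p : Y → ℝ} (h : (prop f p).Nonempty) (r : R) :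
    0 ≤ condRegret f r p := by
  obtain ⟨r₀, h₀⟩ := h
  rw [condRegret_eq h₀]
  exact sub_nonneg.2 (h₀ r)

theorem condRegret_eq_zero {p : Y → ℝ} {r : R} (h : r ∈ prop f p) : condRegret f r p = 0 := by
  rw [condRegret_eq h, sub_self]

theorem condRegret_pos {p : Y → ℝ} (h : (prop f p).Nonempty) {r : R} (hr : r ∉ prop f p) :
    0 < condRegret f r p := by
  obtain ⟨r₀, h₀⟩ := h
  rw [condRegret_eq h₀, sub_pos]
  by_contra hle
  exact hr fun r' => (not_lt.1 hle).trans (h₀ r')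

theorem prop_nonempty_of_finite [Finite R] [Nonempty R] (f : R → Y → ℝ≥0) (p : Y → ℝ) :
    (prop f p).Nonempty :=
  Finite.exists_min fun r => expectedLoss f r p

theorem continuous_expectedLoss (f : R → Y → ℝ≥0) (r : R) :
    Continuous fun p : Y → ℝ => expectedLoss f r p := by
  unfold expectedLoss
  fun_prop

theorem expectedLoss_combo (f : R → Y → ℝ≥0) (r : R) (p q : Y → ℝ) (a b : ℝ) :
    expectedLoss f r (a • p + b • q) = a * expectedLoss f r p + b * expectedLoss f r q := by
  simp only [expectedLoss, Finset.mul_sum, ← Finset.sum_add_distrib, Pi.add_apply, Pi.smul_apply,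
    smul_eq_mul]
  exact Finset.sum_congr rfl fun y _ => by ring

theorem ofReal_expectedLoss (f : R → Y → ℝ≥0) (r : R) {p : Y → ℝ} (hp : p ∈ stdSimplex ℝ Y) :
    ENNReal.ofReal (expectedLoss f r p) = ∑ y, ENNReal.ofReal (p y) * (f r y : ℝ≥0∞) := by
  rw [expectedLoss, ENNReal.ofReal_sum_of_nonneg fun y _ =>
    mul_nonneg (hp.1 y) (NNReal.coe_nonneg _)]
  refine Finset.sum_congr rfl fun y _ => ?_
  rw [ENNReal.ofReal_mul (hp.1 y), ENNReal.ofReal_coe_nnreal]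

end Basic

/-! ### Faces of a polyhedral loss -/

section Faces

variable {Y : Type*} {d : ℕ} {L : (Fin d → ℝ) → Y → ℝ≥0}

/-- Along every direction `v`, the directional growth of `L` at `u` is at most the growth of `L`
over the step `v` starting at `u'`. -/
def GrowthLE (L : (Fin d → ℝ) → Y → ℝ≥0) (u u' : Fin d → ℝ) : Prop :=
  ∀ v : Fin d → ℝ, ∀ y, ∀ᶠ s : ℝ in 𝓝[>] 0,
    (L (u + s • v) y : ℝ) ≤ L u y + s * ((L (u' + v) y : ℝ) - L u' y)

/-- The index encodes which affine pieces are active, for all labels at once. A piece active at both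
reports grows along `v` no faster than the whole maximum does from `u'`; an inactive piece stays
below for small steps. -/
theorem exists_face_index [Finite Y] (hL : IsPolyhedralLoss L) :
    ∃ (n : ℕ) (σ : (Fin d → ℝ) → Fin n), ∀ u u', σ u = σ u' → GrowthLE L u u' := by
  choose s hs hLs using hL
  let τ : (Fin d → ℝ) → ∀ y, Set (s y) := fun u y => {t | t.1.1 ⬝ᵥ u + t.1.2 = L u y}
  obtain ⟨n, ⟨e⟩⟩ := Finite.exists_equiv_fin (∀ y, Set (s y))
  refine ⟨n, fun u => e (τ u), fun u u' h v y => ?_⟩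
  have hτ : τ u = τ u' := e.injective h
  have le : ∀ w, ∀ t ∈ s y, t.1 ⬝ᵥ w + t.2 ≤ L w y := fun w t ht =>
    (Finset.le_sup' (fun t : (Fin d → ℝ) × ℝ => t.1 ⬝ᵥ w + t.2) ht).trans_eq (hLs y w).symm
  have key : ∀ t ∈ s y, ∀ᶠ r : ℝ in 𝓝[>] 0,
      t.1 ⬝ᵥ (u + r • v) + t.2 ≤ L u y + r * ((L (u' + v) y : ℝ) - L u' y) := by
    intro t ht
    by_cases hact : t.1 ⬝ᵥ u + t.2 = L u y
    · have hact' : t.1 ⬝ᵥ u' + t.2 = L u' y := by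
        have h1 : (⟨t, ht⟩ : s y) ∈ τ u y := hact
        rw [hτ] at h1
        exact h1
      filter_upwards [self_mem_nhdsWithin] with r hr
      have h2 := le (u' + v) t ht
      rw [dotProduct_add] at h2
      rw [dotProduct_add, dotProduct_smul, smul_eq_mul]
      have := mul_le_mul_of_nonneg_left (show t.1 ⬝ᵥ v ≤ (L (u' + v) y : ℝ) - L u' y by linarith)
        (le_of_lt hr)
      linarith
    · have hlt : t.1 ⬝ᵥ u + t.2 < L u y := lt_of_le_of_ne (le u t ht) hact
      have hc1 : Tendsto (fun r : ℝ => t.1 ⬝ᵥ (u + r • v) + t.2) (𝓝[>] 0)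
          (𝓝 (t.1 ⬝ᵥ u + t.2)) := by
        have : Continuous fun r : ℝ => t.1 ⬝ᵥ u + r * (t.1 ⬝ᵥ v) + t.2 := by fun_prop
        have := (this.tendsto 0).mono_left (nhdsWithin_le_nhds (s := Ioi 0))
        simpa [dotProduct_add, dotProduct_smul] using this
      have hc2 : Tendsto (fun r : ℝ => (L u y : ℝ) + r * ((L (u' + v) y : ℝ) - L u' y)) (𝓝[>] 0)
          (𝓝 (L u y)) := by
        have : Continuous fun r : ℝ => (L u y : ℝ) + r * ((L (u' + v) y : ℝ) - L u' y) := by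
          fun_prop
        have := (this.tendsto 0).mono_left (nhdsWithin_le_nhds (s := Ioi 0))
        simpa using this
      exact (hc1.eventually_lt hc2 hlt).mono fun _ => le_of_lt
  filter_upwards [(Filter.eventually_all_finset (s y)).2 key] with r hr
  exact (hLs y (u + r • v)).trans_le (Finset.sup'_le _ _ hr)

theorem IsPolyhedralLoss.exists_lipschitz [Finite Y] (hL : IsPolyhedralLoss L) :
    ∃ K : ℝ, 0 < K ∧ ∀ y u v, (L u y : ℝ) ≤ L v y + K * dist u v := by
  have h1 : ∀ y, ∃ K : ℝ, ∀ u v, (L u y : ℝ) ≤ L v y + K * dist u v := by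
    intro y
    obtain ⟨s, hs, hLs⟩ := hL y
    refine ⟨∑ t ∈ s, ∑ i, |t.1 i|, fun u v => ?_⟩
    simp only [hLs]
    refine Finset.sup'_le _ _ fun t ht => ?_
    have h2 : t.1 ⬝ᵥ u - t.1 ⬝ᵥ v ≤ (∑ i, |t.1 i|) * dist u v := by
      rw [← dotProduct_sub, dotProduct, Finset.sum_mul]
      refine Finset.sum_le_sum fun i _ => (le_abs_self _).trans ?_
      rw [abs_mul]
      exact mul_le_mul_of_nonneg_left (dist_le_pi_dist u v i) (abs_nonneg _)
    have h3 : (∑ i, |t.1 i|) ≤ ∑ t ∈ s, ∑ i, |t.1 i| :=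
      Finset.single_le_sum (f := fun t : (Fin d → ℝ) × ℝ => ∑ i, |t.1 i|)
        (fun t _ => Finset.sum_nonneg fun i _ => abs_nonneg _) ht
    have h4 := mul_le_mul_of_nonneg_right h3 (dist_nonneg (x := u) (y := v))
    have h5 := Finset.le_sup' (fun t : (Fin d → ℝ) × ℝ => t.1 ⬝ᵥ v + t.2) ht
    linarith
  choose K hK using h1
  obtain ⟨M, hM⟩ := (Set.finite_range K).bddAbove
  refine ⟨max M 1, by positivity, fun y u v => (hK y u v).trans ?_⟩
  have := mul_le_mul_of_nonneg_right ((hM ⟨y, rfl⟩).trans (le_max_left M 1))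
    (dist_nonneg (x := u) (y := v))
  linarith

theorem IsPolyhedralLoss.continuous (hL : IsPolyhedralLoss L) (y : Y) :
    Continuous fun u => L u y := by
  obtain ⟨s, hs, hLs⟩ := hL y
  refine NNReal.isEmbedding_coe.continuous_iff.2 ?_
  change Continuous fun u => (L u y : ℝ)
  rw [funext hLs]
  refine Continuous.finset_sup'_apply hs fun t _ => ?_
  simp only [dotProduct]
  fun_prop

variable [Fintype Y]

theorem GrowthLE.expectedLoss {u u' : Fin d → ℝ} (h : GrowthLE L u u') {p : Y → ℝ}
    (hp : p ∈ stdSimplex ℝ Y) (v : Fin d → ℝ) : ∀ᶠ s : ℝ in 𝓝[>] 0,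
      expectedLoss L (u + s • v) p ≤
        expectedLoss L u p + s * (expectedLoss L (u' + v) p - expectedLoss L u' p) := by
  filter_upwards [Filter.eventually_all.2 (h v)] with s hs
  simp only [PolyhedralSurrogate.expectedLoss, ← Finset.sum_sub_distrib, Finset.mul_sum,
    ← Finset.sum_add_distrib]
  refine Finset.sum_le_sum fun y _ => ?_
  have := mul_le_mul_of_nonneg_left (hs y) (hp.1 y)
  linarith

/-- At a minimizer no directional growth is negative, and the growth at `u` along `w - u'` bounds
the change of expected loss from `u'` to `w` from below. -/
theorem GrowthLE.mem_prop {u u' : Fin d → ℝ} (h : GrowthLE L u u') {p : Y → ℝ}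
    (hp : p ∈ stdSimplex ℝ Y) (hu : u ∈ prop L p) : u' ∈ prop L p := by
  intro w
  obtain ⟨s, hs, hs0⟩ := ((h.expectedLoss hp (w - u')).and self_mem_nhdsWithin).exists
  have h0 : 0 ≤ s * (PolyhedralSurrogate.expectedLoss L w p -
      PolyhedralSurrogate.expectedLoss L u' p) := by
    have := hu (u + s • (w - u'))
    rw [add_sub_cancel] at hs
    linarith
  exact sub_nonneg.1 (nonneg_of_mul_nonneg_right h0 hs0)

/-- A polyhedral expected loss attains its minimum and grows at least linearly with the distance to
the set of minimizers. -/
theorem exists_error_bound (hL : IsPolyhedralLoss L) {p : Y → ℝ} (hp : p ∈ stdSimplex ℝ Y) :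
    ∃ κ : ℝ, 0 < κ ∧ ∀ u, ∃ w ∈ prop L p,
      κ * dist w u ≤ expectedLoss L u p - expectedLoss L w p := by
  obtain ⟨n, σ, hσ⟩ := exists_face_index hL
  have hslope : ∀ i, ∃ κ : ℝ, 0 < κ ∧ ∀ u, σ u = i → u ∉ prop L p →
      ∃ v, ∀ᶠ s : ℝ in 𝓝[>] 0,
        expectedLoss L (u + s • v) p + κ * ‖s • v‖ < expectedLoss L u p := by
    intro i
    by_cases hi : ∃ u', σ u' = i ∧ u' ∉ prop L p
    · obtain ⟨u', hu', hnot⟩ := hi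
      obtain ⟨w, hw⟩ : ∃ w, expectedLoss L w p < expectedLoss L u' p := by
        by_contra hcon
        push Not at hcon
        exact hnot hcon
      set δ := expectedLoss L u' p - expectedLoss L w p with hδ
      have hδ0 : 0 < δ := sub_pos.2 hw
      -- One nonoptimal report of a face gives a descent direction and a rate valid on the whole
      -- face. The `+ 1` makes the descent strict.
      refine ⟨δ / (‖w - u'‖ + 1), by positivity, fun u hu _ => ⟨w - u', ?_⟩⟩
      filter_upwards [(hσ u u' (hu.trans hu'.symm)).expectedLoss hp (w - u'),
        self_mem_nhdsWithin] with s hs hs0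
      have hs0 : 0 < s := hs0
      rw [add_sub_cancel] at hs
      rw [norm_smul, Real.norm_of_nonneg hs0.le]
      have h1 : δ / (‖w - u'‖ + 1) * ‖w - u'‖ < δ := by
        rw [div_mul_eq_mul_div, div_lt_iff₀ (by positivity)]
        nlinarith
      have h2 := mul_lt_mul_of_pos_left h1 hs0
      nlinarith
    · exact ⟨1, one_pos, fun u hu hnot => (hi ⟨u, hu, hnot⟩).elim⟩
  choose κ hκ0 hκ using hslope
  obtain ⟨k, hk, hk0⟩ : ∃ k, (∀ i, k ≤ κ i) ∧ 0 < k := by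
    have : ∀ᶠ k in 𝓝[>] (0 : ℝ), ∀ i, k ≤ κ i := Filter.eventually_all.2 fun i =>
      ((gt_mem_nhds (hκ0 i)).filter_mono nhdsWithin_le_nhds).mono fun _ => le_of_lt
    exact (this.and self_mem_nhdsWithin).exists
  refine ⟨k, hk0, fun u => ?_⟩
  have hcont : Continuous fun w => expectedLoss L w p := by
    unfold expectedLoss
    exact continuous_finsetSum _ fun y _ =>
      continuous_const.mul (NNReal.continuous_coe.comp (hL.continuous y))
  -- Penalize by the distance to `u` with a slope below all descent rates. A nonoptimal penalized
  -- minimizer could still be improved by descent, so it is optimal; comparing it with `u` itself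
  -- gives the bound.
  obtain ⟨w, hw⟩ : ∃ w, ∀ w', expectedLoss L w p + k * dist w u ≤
      expectedLoss L w' p + k * dist w' u := by
    refine Continuous.exists_forall_le
      (f := fun w => expectedLoss L w p + k * dist w u) (by fun_prop) ?_
    refine tendsto_atTop_mono (f := fun w => k * dist w u) (fun w => ?_) ?_
    · have := expectedLoss_nonneg hp L w
      linarith
    · exact (tendsto_dist_right_cocompact_atTop u).const_mul_atTop hk0
  refine ⟨w, ?_, ?_⟩
  · by_contra hnot
    obtain ⟨v, hv⟩ := hκ (σ w) w rfl hnot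
    obtain ⟨s, hs⟩ := hv.exists
    have h1 := hw (w + s • v)
    have h2 : dist (w + s • v) u ≤ ‖s • v‖ + dist w u :=
      (dist_triangle _ w _).trans (by rw [dist_eq_norm, add_sub_cancel_left])
    have h3 := mul_le_mul_of_nonneg_left h2 hk0.le
    have h4 := mul_le_mul_of_nonneg_right (hk (σ w)) (norm_nonneg (s • v))
    linarith
  · have := hw u
    rw [dist_self] at this
    linarith

theorem prop_nonempty (hL : IsPolyhedralLoss L) {p : Y → ℝ} (hp : p ∈ stdSimplex ℝ Y) :
    (prop L p).Nonempty := by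
  obtain ⟨κ, -, h⟩ := exists_error_bound hL hp
  obtain ⟨w, hw, -⟩ := h 0
  exact ⟨w, hw⟩

theorem hoffmanAt_lt_top (hL : IsPolyhedralLoss L) {p : Y → ℝ} (hp : p ∈ stdSimplex ℝ Y) :
    hoffmanAt L p < ∞ := by
  obtain ⟨κ, hκ, h⟩ := exists_error_bound hL hp
  refine lt_of_le_of_lt (sInf_le (a := ENNReal.ofReal κ⁻¹) fun u => ?_) ENNReal.ofReal_lt_top
  obtain ⟨w, hw, hle⟩ := h u
  refine (Metric.infEDist_le_edist_of_mem hw).trans ?_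
  rw [condRegret_eq hw, ← ENNReal.ofReal_mul (by positivity), edist_dist, dist_comm]
  refine ENNReal.ofReal_le_ofReal ?_
  rw [inv_mul_eq_div, le_div_iff₀ hκ]
  linarith

/-- The infimum defining the constant is attained. Zero regret is treated separately, since there
one cannot divide by it. -/
theorem infEDist_le_hoffmanAt (hL : IsPolyhedralLoss L) {p : Y → ℝ} (hp : p ∈ stdSimplex ℝ Y)
    (u : Fin d → ℝ) :
    Metric.infEDist u (prop L p) ≤ hoffmanAt L p * ENNReal.ofReal (condRegret L u p) := by
  by_cases h0 : ENNReal.ofReal (condRegret L u p) = 0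
  · obtain ⟨H, hH, -⟩ := sInf_lt_iff.1 (hoffmanAt_lt_top hL hp)
    simpa [h0] using hH u
  · rw [← ENNReal.div_le_iff h0 ENNReal.ofReal_ne_top]
    exact le_sInf fun H hH => (ENNReal.div_le_iff h0 ENNReal.ofReal_ne_top).2 (hH u)

/-- Finitely many reports suffice to minimize every expected loss. -/
theorem exists_finite_optimal (hL : IsPolyhedralLoss L) :
    ∃ (n : ℕ) (U : Fin n → Fin d → ℝ), (∀ p ∈ stdSimplex ℝ Y, ∃ i, U i ∈ prop L p) ∧
      ∀ u, ∃ i, levelSet L u = levelSet L (U i) := by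
  obtain ⟨n, σ, hσ⟩ := exists_face_index hL
  have hrep : ∀ u, σ (Function.invFun σ (σ u)) = σ u := fun u => Function.invFun_eq ⟨u, rfl⟩
  refine ⟨n, Function.invFun σ, fun p hp => ?_, fun u => ⟨σ u, ?_⟩⟩
  · obtain ⟨u, hu⟩ := prop_nonempty hL hp
    exact ⟨σ u, (hσ _ _ (hrep u).symm).mem_prop hp hu⟩
  · ext p
    exact ⟨fun h => ⟨h.1, (hσ _ _ (hrep u).symm).mem_prop h.1 h.2⟩,
      fun h => ⟨h.1, (hσ _ _ (hrep u)).mem_prop h.1 h.2⟩⟩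

/-- Each set of minimizers is a union of faces. -/
theorem finite_range_prop (hL : IsPolyhedralLoss L) : (prop L '' stdSimplex ℝ Y).Finite := by
  obtain ⟨n, σ, hσ⟩ := exists_face_index hL
  refine ((Set.finite_univ (α := Set (Fin n))).image fun A => σ ⁻¹' A).subset ?_
  rintro _ ⟨p, hp, rfl⟩
  refine ⟨σ '' prop L p, mem_univ _, Subset.antisymm ?_ (subset_preimage_image _ _)⟩
  rintro u ⟨u', hu', h⟩
  exact (hσ _ _ h).mem_prop hp hu'

end Faces

/-! ### Extreme points of polyhedra -/

/-- An extreme point is determined by its set of tight constraints: if `q` in the polyhedron has the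
same tight set as `x`, one can step from `x` slightly away from `q` without leaving, so `x` is
interior to a segment ending at `q`. -/
theorem finite_extremePoints_of_halfspaces {E ι : Type*} [AddCommGroup E] [Module ℝ E]
    [Finite ι] (g : ι → E →ₗ[ℝ] ℝ) (c : ι → ℝ) :
    ({x | ∀ i, g i x ≤ c i}.extremePoints ℝ).Finite := by
  set P : Set E := {x | ∀ i, g i x ≤ c i} with hP
  let A : E → Set ι := fun x => {i | g i x = c i}
  refine Set.Finite.of_finite_image (f := A) (Set.toFinite _) fun x hx q hq hA => ?_
  have hev : ∀ᶠ t : ℝ in 𝓝[>] 0, ∀ i, g i (x - t • (q - x)) ≤ c i := by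
    refine Filter.eventually_all.2 fun i => ?_
    by_cases hi : g i x = c i
    · have hq' : g i q = c i := by
        have : i ∈ A x := hi
        rwa [hA] at this
      exact Filter.Eventually.of_forall fun t => by simp [hi, hq']
    · have hlt : g i x < c i := lt_of_le_of_ne (hx.1 i) hi
      have hcont : Continuous fun t : ℝ => g i x - t * (g i q - g i x) := by fun_prop
      have h0 : Tendsto (fun t : ℝ => g i x - t * (g i q - g i x)) (𝓝[>] 0) (𝓝 (g i x)) := by
        simpa using (hcont.tendsto 0).mono_left (nhdsWithin_le_nhds (s := Ioi 0))
      filter_upwards [h0.eventually (gt_mem_nhds hlt)] with t ht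
      simpa using ht.le
  obtain ⟨t, ht, ht0⟩ := (hev.and self_mem_nhdsWithin).exists
  have ht0 : 0 < t := ht0
  have h1 : x - t • (q - x) ∈ P := ht
  have h2 : x ∈ openSegment ℝ (x - t • (q - x)) q := by
    refine ⟨1 / (1 + t), t / (1 + t), by positivity, by positivity, by field_simp, ?_⟩
    have : (1 : ℝ) + t ≠ 0 := by positivity
    match_scalars <;> field_simp <;> ring
  exact ((mem_extremePoints.1 hx).2 _ h1 _ hq.1 h2).2.symm

/-! ### Level sets -/

section LevelSets

variable {Y : Type*} [Fintype Y] {d : ℕ} {L : (Fin d → ℝ) → Y → ℝ≥0}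

theorem isClosed_levelSet {R : Type*} (f : R → Y → ℝ≥0) (r : R) : IsClosed (levelSet f r) := by
  have : levelSet f r =
      stdSimplex ℝ Y ∩ ⋂ r', {p | expectedLoss f r p ≤ expectedLoss f r' p} := by
    ext p
    simp [levelSet, prop]
  rw [this]
  exact (isClosed_stdSimplex ℝ Y).inter (isClosed_iInter fun r' =>
    isClosed_le (continuous_expectedLoss f r) (continuous_expectedLoss f r'))

theorem isCompact_levelSet {R : Type*} (f : R → Y → ℝ≥0) (r : R) : IsCompact (levelSet f r) :=
  (isCompact_stdSimplex ℝ Y).of_isClosed_subset (isClosed_levelSet f r) fun _ h => h.1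

theorem convex_levelSet {R : Type*} (f : R → Y → ℝ≥0) (r : R) : Convex ℝ (levelSet f r) := by
  intro p hp q hq a b ha hb hab
  refine ⟨convex_stdSimplex ℝ Y hp.1 hq.1 ha hb hab, fun r' => ?_⟩
  rw [expectedLoss_combo, expectedLoss_combo]
  exact add_le_add (mul_le_mul_of_nonneg_left (hp.2 r') ha)
    (mul_le_mul_of_nonneg_left (hq.2 r') hb)

/-- The expected loss as a linear functional of the distribution. -/
def expectedLossLin {R : Type*} (f : R → Y → ℝ≥0) (r : R) : (Y → ℝ) →ₗ[ℝ] ℝ where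
  toFun := expectedLoss f r
  map_add' p q := by simpa using expectedLoss_combo f r p q 1 1
  map_smul' a p := by simpa using expectedLoss_combo f r p 0 a 0

theorem finite_extremePoints_levelSet (hL : IsPolyhedralLoss L) (u : Fin d → ℝ) :
    ((levelSet L u).extremePoints ℝ).Finite := by
  obtain ⟨n, U, hU, -⟩ := exists_finite_optimal hL
  let total : (Y → ℝ) →ₗ[ℝ] ℝ := ∑ y, LinearMap.proj y
  -- Finitely many half-spaces: nonnegativity, total mass one as two inequalities, and comparison
  -- with finitely many reports that suffice for optimality.
  let g : (Y ⊕ Bool) ⊕ Fin n → (Y → ℝ) →ₗ[ℝ] ℝ :=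
    Sum.elim (Sum.elim (fun y => -LinearMap.proj y) fun b => if b then total else -total)
      fun i => expectedLossLin L u - expectedLossLin L (U i)
  let c : (Y ⊕ Bool) ⊕ Fin n → ℝ :=
    Sum.elim (Sum.elim (fun _ => 0) fun b => if b then 1 else -1) fun _ => 0
  suffices h : levelSet L u = {p | ∀ i, g i p ≤ c i} from
    h ▸ finite_extremePoints_of_halfspaces g c
  refine Set.ext fun p => ?_
  have htot : total p = ∑ y, p y := by simp [total]
  have hlin : ∀ r, expectedLossLin L r p = expectedLoss L r p := fun _ => rfl
  simp only [mem_ofPred_eq, Sum.forall, g, c, Sum.elim_inl, Sum.elim_inr, Bool.forall_bool,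
    LinearMap.neg_apply, LinearMap.sub_apply, LinearMap.proj_apply, hlin, if_true, htot,
    Bool.false_eq_true, if_false, Left.neg_nonpos_iff, sub_nonpos, neg_le_neg_iff]
  constructor
  · rintro ⟨⟨h0, h1⟩, h⟩
    exact ⟨⟨h0, h1.ge, h1.le⟩, fun i => h (U i)⟩
  · rintro ⟨⟨h0, h1, h2⟩, h⟩
    have hp : p ∈ stdSimplex ℝ Y := ⟨h0, le_antisymm h2 h1⟩
    obtain ⟨i, hi⟩ := hU p hp
    exact ⟨hp, fun r => (h i).trans (hi r)⟩

theorem convexHull_extremePoints_levelSet (hL : IsPolyhedralLoss L) (u : Fin d → ℝ) :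
    convexHull ℝ ((levelSet L u).extremePoints ℝ) = levelSet L u := by
  rw [← ((finite_extremePoints_levelSet hL u).isClosed_convexHull ℝ).closure_eq]
  exact closure_convexHull_extremePoints (isCompact_levelSet L u) (convex_levelSet L u)

/-- The full-dimensional level sets cover the simplex. -/
theorem exists_mem_fullDim_levelSet (hL : IsPolyhedralLoss L) {p : Y → ℝ}
    (hp : p ∈ stdSimplex ℝ Y) :
    ∃ u, affineSpan ℝ (levelSet L u) = affineSpan ℝ (stdSimplex ℝ Y) ∧ p ∈ levelSet L u := by
  obtain ⟨n, U, hU, -⟩ := exists_finite_optimal hL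
  let S := stdSimplex ℝ Y
  let full : Fin n → Prop := fun i =>
    affineSpan ℝ (levelSet L (U i)) = affineSpan ℝ (stdSimplex ℝ Y)
  let V : {i // ¬ full i} → Set S := fun i => {q | (q : Y → ℝ) ∉ levelSet L (U i)}
  have hVo : ∀ i, IsOpen (V i) := fun i =>
    ((isClosed_levelSet L (U i)).preimage continuous_subtype_val).isOpen_compl
  -- A level set that is not full-dimensional misses the direction of some `r` in the simplex:
  -- moving from `q` towards `r` leaves its affine span at once. By Baire, the points outside all
  -- such level sets are dense, and the full-dimensional ones form a closed set containing them.
  have hVd : ∀ i, Dense (V i) := by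
    rintro ⟨i, hi⟩ q
    obtain ⟨r, hr, hri⟩ : ∃ r ∈ stdSimplex ℝ Y, r ∉ affineSpan ℝ (levelSet L (U i)) := by
      by_contra! hcon
      exact hi (le_antisymm (affineSpan_mono ℝ fun _ h => h.1) (affineSpan_le.2 hcon))
    by_cases hq : (q : Y → ℝ) ∈ levelSet L (U i)
    · let z : ℝ → Y → ℝ := fun t => AffineMap.lineMap (q : Y → ℝ) r t
      have hz : Tendsto z (𝓝[>] 0) (𝓝 q) := by
        have : Continuous z := AffineMap.lineMap_continuous
        simpa [z] using (this.tendsto 0).mono_left (nhdsWithin_le_nhds (s := Ioi 0))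
      have hzS : ∀ᶠ t in 𝓝[>] (0 : ℝ), z t ∈ S ∧ z t ∉ levelSet L (U i) := by
        filter_upwards [Ioo_mem_nhdsGT (zero_lt_one' ℝ)] with t ht
        refine ⟨(convex_stdSimplex ℝ Y).lineMap_mem q.2 hr ⟨ht.1.le, ht.2.le⟩, fun hmem => hri ?_⟩
        have h1 := AffineMap.lineMap_mem (Q := affineSpan ℝ (levelSet L (U i))) t⁻¹
          (subset_affineSpan ℝ _ hq) (subset_affineSpan ℝ _ hmem)
        convert h1 using 1
        have ht0 : t ≠ 0 := ht.1.ne'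
        simp [z, AffineMap.lineMap_apply, smul_smul, ht0]
      rw [closure_subtype]
      refine mem_closure_of_tendsto hz (hzS.mono fun t ht => ⟨⟨z t, ht.1⟩, ht.2, rfl⟩)
    · exact subset_closure hq
  have : CompactSpace S := isCompact_iff_compactSpace.1 (isCompact_stdSimplex ℝ Y)
  have hD := dense_iInter_of_isOpen hVo hVd
  have hcl : IsClosed (⋃ i : {i // full i}, {q : S | (q : Y → ℝ) ∈ levelSet L (U i)}) :=
    isClosed_iUnion_of_finite fun i =>
      (isClosed_levelSet L (U i)).preimage continuous_subtype_val
  have hsub : (⋂ i, V i) ⊆ ⋃ i : {i // full i}, {q : S | (q : Y → ℝ) ∈ levelSet L (U i)} := by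
    intro q hq
    obtain ⟨i, hi⟩ := hU q q.2
    by_cases hf : full i
    · exact mem_iUnion.2 ⟨⟨i, hf⟩, q.2, hi⟩
    · exact (mem_iInter.1 hq ⟨i, hf⟩ ⟨q.2, hi⟩).elim
  have hmem := (hcl.closure_subset_iff.2 hsub) (hD ⟨p, hp⟩)
  obtain ⟨i, hi⟩ := mem_iUnion.1 hmem
  exact ⟨U i, i.2, hi⟩

theorem levelVertices_subset : levelVertices L ⊆ stdSimplex ℝ Y := by
  rintro q ⟨u, -, hq⟩
  exact hq.1.1

theorem levelVertices_nonempty [Nonempty Y] (hL : IsPolyhedralLoss L) :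
    (levelVertices L).Nonempty := by
  classical
  obtain ⟨y⟩ := ‹Nonempty Y›
  obtain ⟨u, hu, hp⟩ := exists_mem_fullDim_levelSet hL (single_mem_stdSimplex ℝ y)
  obtain ⟨q, hq⟩ := (isCompact_levelSet L u).extremePoints_nonempty ⟨_, hp⟩
  exact ⟨q, u, hu, hq⟩

theorem finite_levelVertices (hL : IsPolyhedralLoss L) : (levelVertices L).Finite := by
  obtain ⟨n, U, -, hU⟩ := exists_finite_optimal hL
  refine (Set.finite_iUnion fun i => finite_extremePoints_levelSet hL (U i)).subset ?_
  rintro q ⟨u, -, hq⟩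
  obtain ⟨i, hi⟩ := hU u
  exact mem_iUnion.2 ⟨i, hi ▸ hq⟩

theorem hoffman_lt_top (hL : IsPolyhedralLoss L) : hoffman L < ∞ := by
  have hfin := finite_levelVertices hL
  refine lt_of_le_of_lt (iSup₂_le fun q hq => ?_)
    (ENNReal.sum_lt_top (s := hfin.toFinset) (f := hoffmanAt L) |>.2 fun q hq =>
      hoffmanAt_lt_top hL (levelVertices_subset (hfin.mem_toFinset.1 hq)))
  exact Finset.single_le_sum (fun _ _ => zero_le) (hfin.mem_toFinset.2 hq)

end LevelSets

/-! ### Calibration and separation -/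

section Calibration

variable {R Y : Type*} [Fintype Y] {d : ℕ} {L : (Fin d → ℝ) → Y → ℝ≥0}
  {ψ : (Fin d → ℝ) → R} {ℓ : R → Y → ℝ≥0}

theorem iInf_badRegrets_pos_iff {p : Y → ℝ} :
    (0 < ⨅ b ∈ badRegrets L ψ ℓ p, (b : EReal)) ↔
      ∃ c : ℝ, 0 < c ∧ ∀ u, ψ u ∉ prop ℓ p → c ≤ condRegret L u p := by
  constructor
  · intro h
    obtain ⟨c, hc0, hc⟩ := EReal.lt_iff_exists_real_btwn.1 h
    refine ⟨c, EReal.coe_pos.1 hc0, fun u hu => ?_⟩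
    exact EReal.coe_le_coe_iff.1 (hc.le.trans (iInf₂_le (condRegret L u p) ⟨u, hu, rfl⟩))
  · rintro ⟨c, hc0, hc⟩
    refine (EReal.coe_pos.2 hc0).trans_le (le_iInf₂ ?_)
    rintro _ ⟨u, hu, rfl⟩
    exact EReal.coe_le_coe_iff.2 (hc u hu)

theorem Calibrated.mem_prop (h : Calibrated L ψ ℓ) {p : Y → ℝ} (hp : p ∈ stdSimplex ℝ Y)
    {u : Fin d → ℝ} (hu : u ∈ prop L p) : ψ u ∈ prop ℓ p := by
  by_contra hnot
  obtain ⟨c, hc0, hc⟩ := iInf_badRegrets_pos_iff.1 (h p hp)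
  have := hc u hnot
  rw [condRegret_eq_zero hu] at this
  linarith

theorem expectedLoss_le_add_dist {K : ℝ} (hK : ∀ y u v, (L u y : ℝ) ≤ L v y + K * dist u v)
    {p : Y → ℝ} (hp : p ∈ stdSimplex ℝ Y) (u v : Fin d → ℝ) :
    expectedLoss L u p ≤ expectedLoss L v p + K * dist u v := by
  have h : K * dist u v = ∑ y, p y * (K * dist u v) := by rw [← Finset.sum_mul, hp.2, one_mul]
  rw [h]
  simp only [expectedLoss, ← Finset.sum_add_distrib, ← mul_add]
  exact Finset.sum_le_sum fun y _ => mul_le_mul_of_nonneg_left (hK y u v) (hp.1 y)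

/-- For fixed `p`, the calibration gap `c` and a Lipschitz constant `K` of the surrogate force
distance at least `c / K`. -/
theorem Calibrated.linkSeparation_pos [Finite R] (hL : IsPolyhedralLoss L)
    (h : Calibrated L ψ ℓ) : 0 < linkSeparation L ψ ℓ := by
  obtain ⟨K, hK0, hK⟩ := hL.exists_lipschitz
  have hpt : ∀ p ∈ stdSimplex ℝ Y, ∀ᶠ ε : ℝ≥0 in 𝓝[>] 0,
      ∀ u, ψ u ∉ prop ℓ p → (ε : ℝ≥0∞) < Metric.infEDist u (prop L p) := by
    intro p hp
    obtain ⟨c, hc0, hc⟩ := iInf_badRegrets_pos_iff.1 (h p hp)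
    have hlt : (0 : ℝ≥0) < Real.toNNReal (c / K) := by simpa using div_pos hc0 hK0
    filter_upwards [(gt_mem_nhds hlt).filter_mono nhdsWithin_le_nhds] with ε hε u hu
    refine (ENNReal.coe_lt_coe.2 hε).trans_le (Metric.le_infEDist.2 fun w hw => ?_)
    have h1 := hc u hu
    rw [condRegret_eq hw] at h1
    have h2 := expectedLoss_le_add_dist hK hp u w
    rw [edist_dist]
    refine ENNReal.ofReal_le_ofReal ?_
    rw [div_le_iff₀ hK0]
    linarith
  -- Separation at `p` depends only on this pair, which takes finitely many values, so a single `ε`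
  -- serves all distributions.
  let code : (Y → ℝ) → Set (Fin d → ℝ) × Set R := fun p => (prop L p, prop ℓ p)
  have hfin : (code '' stdSimplex ℝ Y).Finite :=
    ((finite_range_prop hL).prod (Set.toFinite (Set.univ : Set (Set R)))).subset (by
      rintro _ ⟨p, hp, rfl⟩
      exact ⟨⟨p, hp, rfl⟩, mem_univ _⟩)
  have hall : ∀ᶠ ε : ℝ≥0 in 𝓝[>] 0, ∀ a ∈ code '' stdSimplex ℝ Y,
      ∀ u, ψ u ∉ a.2 → (ε : ℝ≥0∞) < Metric.infEDist u a.1 := by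
    refine (Filter.eventually_all_finite hfin).2 ?_
    rintro _ ⟨p, hp, rfl⟩
    exact hpt p hp
  obtain ⟨ε, hε, hε0⟩ := (hall.and self_mem_nhdsWithin).exists
  have hsep : IsSeparated L ψ ℓ ε := fun p hp u hu => hε _ ⟨p, hp, rfl⟩ u hu
  exact (ENNReal.coe_pos.2 hε0).trans_le (le_iSup₂_of_le ε hsep le_rfl)

theorem linkSeparation_le_infEDist {p : Y → ℝ} (hp : p ∈ stdSimplex ℝ Y) {u : Fin d → ℝ}
    (hu : ψ u ∉ prop ℓ p) : linkSeparation L ψ ℓ ≤ Metric.infEDist u (prop L p) :=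
  iSup₂_le fun _ hε => (hε p hp u hu).le

theorem sub_le_lossRange [Finite R] (ℓ : R → Y → ℝ≥0) (r r' : R) (y : Y) :
    (ℓ r y : ℝ) - ℓ r' y ≤ lossRange ℓ :=
  le_ciSup (f := fun t : R × R × Y => ((ℓ t.1 t.2.2 : ℝ) - (ℓ t.2.1 t.2.2 : ℝ)))
    (Set.finite_range _).bddAbove (r, r', y)

theorem condRegret_le_lossRange [Finite R] [Nonempty R] {p : Y → ℝ} (hp : p ∈ stdSimplex ℝ Y)
    (r : R) : condRegret ℓ r p ≤ lossRange ℓ := by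
  obtain ⟨r₀, h₀⟩ := prop_nonempty_of_finite ℓ p
  have h : lossRange ℓ = ∑ y, p y * lossRange ℓ := by rw [← Finset.sum_mul, hp.2, one_mul]
  rw [condRegret_eq h₀, h]
  simp only [expectedLoss, ← Finset.sum_sub_distrib, ← mul_sub]
  exact Finset.sum_le_sum fun y _ =>
    mul_le_mul_of_nonneg_left (sub_le_lossRange ℓ r r₀ y) (hp.1 y)

/-- The coefficient `C_ℓ H_L / ε_ψ` of the linear regret transfer. -/
noncomputable def transferCoeff (L : (Fin d → ℝ) → Y → ℝ≥0) (ψ : (Fin d → ℝ) → R)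
    (ℓ : R → Y → ℝ≥0) : ℝ≥0∞ :=
  ENNReal.ofReal (lossRange ℓ) * hoffman L / linkSeparation L ψ ℓ

theorem Calibrated.transferCoeff_ne_top [Finite R] (hL : IsPolyhedralLoss L)
    (h : Calibrated L ψ ℓ) : transferCoeff L ψ ℓ ≠ ∞ :=
  ENNReal.div_ne_top (ENNReal.mul_ne_top ENNReal.ofReal_ne_top (hoffman_lt_top hL).ne)
    (h.linkSeparation_pos hL).ne'

theorem Calibrated.condRegret_le_of_vertex [Finite R] (hL : IsPolyhedralLoss L)
    (h : Calibrated L ψ ℓ) {q : Y → ℝ} (hq : q ∈ levelVertices L) (u : Fin d → ℝ) :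
    condRegret ℓ (ψ u) q ≤ (transferCoeff L ψ ℓ).toReal * condRegret L u q := by
  have : Nonempty R := ⟨ψ 0⟩
  have hqS := levelVertices_subset hq
  have hne := prop_nonempty hL hqS
  by_cases hu : ψ u ∈ prop ℓ q
  · rw [condRegret_eq_zero hu]
    exact mul_nonneg ENNReal.toReal_nonneg (condRegret_nonneg hne u)
  have hε0 := (h.linkSeparation_pos hL).ne'
  have hεle := linkSeparation_le_infEDist (L := L) hqS hu
  -- A suboptimal link at `q` excludes infinite separation, so cancelling it below is legitimate.
  have hεtop : linkSeparation L ψ ℓ ≠ ∞ := ne_top_of_le_ne_top (Metric.infEDist_ne_top hne) hεle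
  have hH : linkSeparation L ψ ℓ ≤ hoffman L * ENNReal.ofReal (condRegret L u q) :=
    (hεle.trans (infEDist_le_hoffmanAt hL hqS u)).trans
      (mul_le_mul_left (le_iSup₂ (f := fun q (_ : q ∈ levelVertices L) => hoffmanAt L q) q hq) _)
  have key : ENNReal.ofReal (condRegret ℓ (ψ u) q) ≤
      transferCoeff L ψ ℓ * ENNReal.ofReal (condRegret L u q) := calc
    _ ≤ ENNReal.ofReal (lossRange ℓ) := ENNReal.ofReal_le_ofReal (condRegret_le_lossRange hqS _)
    _ = ENNReal.ofReal (lossRange ℓ) * linkSeparation L ψ ℓ / linkSeparation L ψ ℓ :=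
      (ENNReal.mul_div_cancel_right hε0 hεtop).symm
    _ ≤ ENNReal.ofReal (lossRange ℓ) * (hoffman L * ENNReal.ofReal (condRegret L u q)) /
        linkSeparation L ψ ℓ := by gcongr
    _ = _ := by
      rw [transferCoeff, ENNReal.div_eq_inv_mul, ENNReal.div_eq_inv_mul]
      ring
  rw [← ENNReal.ofReal_toReal (h.transferCoeff_ne_top hL),
    ← ENNReal.ofReal_mul ENNReal.toReal_nonneg] at key
  exact (ENNReal.ofReal_le_ofReal_iff (mul_nonneg ENNReal.toReal_nonneg
    (condRegret_nonneg hne u))).1 key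

/-- The linear regret transfer for conditional distributions. -/
theorem Calibrated.condRegret_le [Finite R] (hL : IsPolyhedralLoss L) (h : Calibrated L ψ ℓ)
    {p : Y → ℝ} (hp : p ∈ stdSimplex ℝ Y) (u : Fin d → ℝ) :
    condRegret ℓ (ψ u) p ≤ (transferCoeff L ψ ℓ).toReal * condRegret L u p := by
  obtain ⟨u₀, hfull, hpu⟩ := exists_mem_fullDim_levelSet hL hp
  set K := (transferCoeff L ψ ℓ).toReal
  -- On the level set of `u₀`, both `u₀` and `ψ u₀` are optimal, so the Bayes risks are linear there
  -- and `φ` is the regret difference to be bounded.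
  let φ : (Y → ℝ) →ₗ[ℝ] ℝ := expectedLossLin ℓ (ψ u) - expectedLossLin ℓ (ψ u₀) -
    K • (expectedLossLin L u - expectedLossLin L u₀)
  have hφ : ∀ q ∈ levelSet L u₀, φ q = condRegret ℓ (ψ u) q - K * condRegret L u q := by
    intro q hq
    rw [condRegret_eq (h.mem_prop hq.1 hq.2), condRegret_eq hq.2]
    rfl
  have hsub : levelSet L u₀ ⊆ {q | φ q ≤ 0} := by
    rw [← convexHull_extremePoints_levelSet hL u₀]
    refine convexHull_min (fun q hq => ?_) (convex_halfSpace_le φ.isLinear 0)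
    have := h.condRegret_le_of_vertex hL ⟨u₀, hfull, hq⟩ u
    rw [mem_ofPred_eq, hφ q hq.1]
    linarith
  have := hsub hpu
  rw [mem_ofPred_eq, hφ p hpu] at this
  linarith

end Calibration

/-! ### Integration over the features -/

section Risk

variable {X R Y : Type*} [MeasurableSpace X] [Fintype Y] [MeasurableSpace Y]

theorem risk_ne_top_of_finite_range {f : R → Y → ℝ≥0} {g : X → R}
    (hg : (range g).Finite) (D : Measure (X × Y)) [IsFiniteMeasure D] : risk f g D ≠ ∞ := by
  obtain ⟨M, hM⟩ := ((hg.prod (Set.finite_univ (α := Y))).image fun z => f z.1 z.2).bddAbove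
  refine ne_top_of_le_ne_top (b := ∫⁻ _, (M : ℝ≥0∞) ∂D) ?_ (lintegral_mono fun z => ?_)
  · rw [lintegral_const]
    exact ENNReal.mul_ne_top ENNReal.coe_ne_top (measure_ne_top D _)
  · exact ENNReal.coe_le_coe.2 (hM ⟨(g z.1, z.2), ⟨⟨z.1, rfl⟩, mem_univ _⟩, rfl⟩)

/-- The data distribution with a fixed feature `x` and label distribution `p`. -/
noncomputable def pointDistribution (x : X) (p : Y → ℝ) : Measure (X × Y) :=
  ∑ y, ENNReal.ofReal (p y) • Measure.dirac (x, y)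

theorem lintegral_pointDistribution (x : X) (p : Y → ℝ) {F : X × Y → ℝ≥0∞} (hF : Measurable F) :
    ∫⁻ z, F z ∂(pointDistribution x p) = ∑ y, ENNReal.ofReal (p y) * F (x, y) := by
  rw [pointDistribution, lintegral_finsetSum_measure]
  refine Finset.sum_congr rfl fun y _ => ?_
  rw [lintegral_smul_measure, lintegral_dirac' _ hF, smul_eq_mul]

theorem isProbabilityMeasure_pointDistribution (x : X) {p : Y → ℝ} (hp : p ∈ stdSimplex ℝ Y) :
    IsProbabilityMeasure (pointDistribution x p) := by
  constructor
  rw [← lintegral_one, lintegral_pointDistribution x p measurable_const]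
  simp only [mul_one]
  rw [← ENNReal.ofReal_sum_of_nonneg fun y _ => hp.1 y, hp.2, ENNReal.ofReal_one]

variable [MeasurableSpace R] [DiscreteMeasurableSpace Y]

theorem measurable_loss_comp {f : R → Y → ℝ≥0} (hf : ∀ y, Measurable fun r => f r y)
    {g : X → R} (hg : Measurable g) :
    Measurable fun z : X × Y => (f (g z.1) z.2 : ℝ≥0∞) :=
  measurable_from_prod_countable_left fun y => ((hf y).comp hg).coe_nnreal_ennreal

theorem risk_pointDistribution (x : X) {p : Y → ℝ} (hp : p ∈ stdSimplex ℝ Y)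
    {f : R → Y → ℝ≥0} (hf : ∀ y, Measurable fun r => f r y) {g : X → R} (hg : Measurable g) :
    risk f g (pointDistribution x p) = ENNReal.ofReal (expectedLoss f (g x) p) := by
  rw [risk, lintegral_pointDistribution x p (measurable_loss_comp hf hg), ofReal_expectedLoss _ _ hp]

theorem regret_pointDistribution (x : X) {p : Y → ℝ} (hp : p ∈ stdSimplex ℝ Y)
    {f : R → Y → ℝ≥0} (hf : ∀ y, Measurable fun r => f r y) (hne : (prop f p).Nonempty)
    {g : X → R} (hg : Measurable g) :
    regret f g (pointDistribution x p) = ENNReal.ofReal (condRegret f (g x) p) := by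
  obtain ⟨r₀, h₀⟩ := hne
  have hinf : ⨅ (g' : X → R) (_ : Measurable g'), risk f g' (pointDistribution x p) =
      ENNReal.ofReal (expectedLoss f r₀ p) := by
    refine le_antisymm ?_ (le_iInf₂ fun g' hg' => ?_)
    · exact (iInf₂_le (fun _ => r₀) measurable_const).trans_eq
        (risk_pointDistribution x hp hf measurable_const)
    · rw [risk_pointDistribution x hp hf hg']
      exact ENNReal.ofReal_le_ofReal (h₀ (g' x))
  rw [regret, hinf, risk_pointDistribution x hp hf hg, condRegret_eq h₀,
    ENNReal.ofReal_sub _ (expectedLoss_nonneg hp f r₀)]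

variable [Nonempty Y]

/-- The conditional distribution of the label given the feature. -/
noncomputable def condProb (D : Measure (X × Y)) [IsFiniteMeasure D] (x : X) (y : Y) : ℝ :=
  (D.condKernel x).real {y}

variable (D : Measure (X × Y)) [IsFiniteMeasure D]

theorem condProb_mem_stdSimplex (x : X) : condProb D x ∈ stdSimplex ℝ Y :=
  ⟨fun _ => measureReal_nonneg, by
    simp only [condProb]
    rw [sum_measureReal_singleton, Finset.coe_univ, probReal_univ]⟩

theorem measurable_condProb (y : Y) : Measurable fun x => condProb D x y :=
  (ProbabilityTheory.Kernel.measurable_coe _ (measurableSet_singleton y)).ennreal_toReal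

theorem risk_eq_lintegral {f : R → Y → ℝ≥0} (hf : ∀ y, Measurable fun r => f r y)
    {g : X → R} (hg : Measurable g) :
    risk f g D = ∫⁻ x, ENNReal.ofReal (expectedLoss f (g x) (condProb D x)) ∂D.fst := by
  rw [risk, ← Measure.lintegral_condKernel (measurable_loss_comp hf hg)]
  refine lintegral_congr fun x => ?_
  rw [lintegral_fintype, ofReal_expectedLoss _ _ (condProb_mem_stdSimplex D x)]
  refine Finset.sum_congr rfl fun y _ => ?_
  rw [condProb, ofReal_measureReal, mul_comm]

theorem measurable_expectedLoss_condProb {f : R → Y → ℝ≥0}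
    (hf : ∀ y, Measurable fun r => f r y) {g : X → R} (hg : Measurable g) :
    Measurable fun x => expectedLoss f (g x) (condProb D x) :=
  Finset.measurable_fun_sum _ fun y _ =>
    (measurable_condProb D y).mul ((hf y).comp hg).coe_nnreal_real

theorem iInf_risk_eq {f : R → Y → ℝ≥0} (hf : ∀ y, Measurable fun r => f r y) {g₀ : X → R}
    (hg₀ : Measurable g₀) (hopt : ∀ x, g₀ x ∈ prop f (condProb D x)) :
    ⨅ (g' : X → R) (_ : Measurable g'), risk f g' D = risk f g₀ D := by
  refine le_antisymm (iInf₂_le g₀ hg₀) (le_iInf₂ fun g' hg' => ?_)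
  rw [risk_eq_lintegral D hf hg₀, risk_eq_lintegral D hf hg']
  exact lintegral_mono fun x => ENNReal.ofReal_le_ofReal (hopt x (g' x))

end Risk

/-! ### From conditional to full regrets, and from consistency to calibration. -/

section Transfer

variable {X Y R : Type*} [MeasurableSpace X] [Fintype Y] [MeasurableSpace Y]
  [DiscreteMeasurableSpace Y] [MeasurableSpace R] [DiscreteMeasurableSpace R] {d : ℕ}
  {ℓ : R → Y → ℝ≥0} {L : (Fin d → ℝ) → Y → ℝ≥0} {ψ : (Fin d → ℝ) → R}

/-- A measurable hypothesis, with finitely many values, which is optimal at every feature. -/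
theorem exists_measurable_optimal [Nonempty Y] (hL : IsPolyhedralLoss L) (D : Measure (X × Y))
    [IsFiniteMeasure D] :
    ∃ (e : ℕ → Fin d → ℝ) (N : X → ℕ), Measurable N ∧ (range e).Finite ∧
      ∀ x, e (N x) ∈ prop L (condProb D x) := by
  classical
  obtain ⟨n, U, hU, -⟩ := exists_finite_optimal hL
  -- Selecting through an index in `ℕ` makes `ψ ∘ e ∘ N` measurable although `ψ` need not be. The
  -- value `0` beyond `n` is only filler.
  let e : ℕ → Fin d → ℝ := fun k => if h : k < n then U ⟨k, h⟩ else 0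
  have hex : ∀ x, ∃ k, ∀ i, expectedLoss L (e k) (condProb D x) ≤
      expectedLoss L (U i) (condProb D x) := fun x => by
    obtain ⟨j, hj⟩ := hU _ (condProb_mem_stdSimplex D x)
    exact ⟨j, fun i => by simpa [e] using hj (U i)⟩
  have hm : ∀ u, Measurable fun x => expectedLoss L u (condProb D x) := fun u =>
    measurable_expectedLoss_condProb D (fun y => (hL.continuous y).measurable)
      (measurable_const (a := u))
  refine ⟨e, fun x => Nat.find (hex x), measurable_find hex fun k => ?_, ?_, fun x u => ?_⟩
  · rw [ofPred_forall]
    exact MeasurableSet.iInter fun i => measurableSet_le (hm _) (hm _)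
  · refine ((Set.finite_range U).insert 0).subset ?_
    rintro _ ⟨k, rfl⟩
    by_cases h : k < n
    · exact Or.inr ⟨⟨k, h⟩, by simp [e, h]⟩
    · exact Or.inl (by simp [e, h])
  · obtain ⟨j, hj⟩ := hU _ (condProb_mem_stdSimplex D x)
    exact (Nat.find_spec (hex x) j).trans (hj u)

/-- The linear regret transfer of a calibrated link. -/
theorem Calibrated.regret_le [Finite R] [Nonempty Y] (hL : IsPolyhedralLoss L)
    (hc : Calibrated L ψ ℓ) (D : Measure (X × Y)) [IsProbabilityMeasure D]
    {h : X → Fin d → ℝ} (hh : Measurable h) (hψ : Measurable (ψ ∘ h)) :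
    regret ℓ (ψ ∘ h) D ≤ transferCoeff L ψ ℓ * regret L h D := by
  obtain ⟨e, N, hN, he, hopt⟩ := exists_measurable_optimal hL D
  have hLm : ∀ y, Measurable fun u => L u y := fun y => (hL.continuous y).measurable
  have hℓm : ∀ y, Measurable fun r => ℓ r y := fun y => Measurable.of_discrete
  have hp := condProb_mem_stdSimplex D
  have hg : Measurable fun x => e (N x) := (measurable_from_nat (f := e)).comp hN
  have hψg : Measurable (ψ ∘ fun x => e (N x)) := (measurable_from_nat (f := ψ ∘ e)).comp hN
  have hK := hc.transferCoeff_ne_top hL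
  rw [regret, regret, iInf_risk_eq D hLm hg hopt,
    iInf_risk_eq D hℓm hψg fun x => hc.mem_prop (hp x) (hopt x), ENNReal.mul_sub fun _ _ => hK]
  have hfin : risk L (fun x => e (N x)) D ≠ ∞ :=
    risk_ne_top_of_finite_range (he.subset (by rintro _ ⟨x, rfl⟩; exact ⟨N x, rfl⟩)) D
  rw [tsub_le_iff_right]
  -- The optimal surrogate risk is finite, so adding it to both sides removes the truncated
  -- subtraction; what remains is a pointwise inequality of sums, even if the risk of `h` is
  -- infinite.
  refine ENNReal.le_of_add_le_add_right (ENNReal.mul_ne_top hK hfin) ?_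
  rw [add_right_comm]
  refine le_trans ?_ (add_le_add_left le_tsub_add _)
  rw [risk_eq_lintegral D hℓm hψ, risk_eq_lintegral D hℓm hψg, risk_eq_lintegral D hLm hg,
    risk_eq_lintegral D hLm hh]
  have hmL := fun {g : X → Fin d → ℝ} (hg : Measurable g) =>
    (measurable_expectedLoss_condProb D hLm hg).ennreal_ofReal
  have hmℓ := fun {g : X → R} (hg : Measurable g) =>
    (measurable_expectedLoss_condProb D hℓm hg).ennreal_ofReal
  rw [← lintegral_const_mul _ (hmL hg), ← lintegral_const_mul _ (hmL hh),
    ← lintegral_add_left (hmℓ hψ), ← lintegral_add_right _ (hmℓ hψg)]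
  refine lintegral_mono fun x => ?_
  have hle := hc.condRegret_le hL (hp x) (h x)
  rw [condRegret_eq (hc.mem_prop (hp x) (hopt x)), condRegret_eq (hopt x)] at hle
  rw [← ENNReal.ofReal_toReal hK]
  have hKn : 0 ≤ (transferCoeff L ψ ℓ).toReal := ENNReal.toReal_nonneg
  have h0 : ∀ u, 0 ≤ expectedLoss L u (condProb D x) := expectedLoss_nonneg (hp x) L
  have h1 : ∀ r, 0 ≤ expectedLoss ℓ r (condProb D x) := expectedLoss_nonneg (hp x) ℓ
  dsimp only [Function.comp]
  rw [← ENNReal.ofReal_mul hKn, ← ENNReal.ofReal_mul hKn,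
    ← ENNReal.ofReal_add (h1 _) (mul_nonneg hKn (h0 _)),
    ← ENNReal.ofReal_add (mul_nonneg hKn (h0 _)) (h1 _)]
  exact ENNReal.ofReal_le_ofReal (by linarith)

/-- With a single feature and constant hypotheses, regrets become conditional regrets. Suboptimal
target regrets stay above some `m > 0` because there are finitely many target reports, whereas `ζ`
is below `m` near `0`; hence bad reports have surrogate regret bounded away from `0`. -/
theorem Consistent.calibrated [Finite R] [Nonempty X] (hL : IsPolyhedralLoss L)
    (hcons : Consistent X L ψ ℓ) : Calibrated L ψ ℓ := by
  obtain ⟨ζ, hζ, hζ0, htr⟩ := hcons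
  intro p hp
  have : Nonempty R := ⟨ψ 0⟩
  obtain ⟨x⟩ := ‹Nonempty X›
  have hneL := prop_nonempty hL hp
  have hneℓ := prop_nonempty_of_finite ℓ p
  have hpoint : ∀ u, ENNReal.ofReal (condRegret ℓ (ψ u) p) ≤
      ζ (condRegret L u p).toNNReal := fun u => by
    have hLr := regret_pointDistribution x hp (fun y => (hL.continuous y).measurable) hneL
      (measurable_const (a := u))
    have hℓr := regret_pointDistribution x hp (fun y => Measurable.of_discrete) hneℓ
      (measurable_const (a := ψ u))
    have := htr _ (isProbabilityMeasure_pointDistribution x hp) (fun _ => u) measurable_const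
      measurable_const (by rw [hLr]; exact ENNReal.ofReal_ne_top)
    rw [hLr] at this
    exact hℓr.symm.trans_le this
  have hm : ∀ᶠ m : ℝ≥0 in 𝓝[>] 0, ∀ r, r ∉ prop ℓ p → (m : ℝ) < condRegret ℓ r p := by
    refine Filter.eventually_all.2 fun r => Filter.eventually_imp_distrib_left.2 fun hr => ?_
    have hlt : (0 : ℝ≥0) < (condRegret ℓ r p).toNNReal := by simpa using condRegret_pos hneℓ hr
    filter_upwards [(gt_mem_nhds hlt).filter_mono nhdsWithin_le_nhds] with m hm
    exact Real.lt_toNNReal_iff_coe_lt.1 hm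
  obtain ⟨m, hm, hm0⟩ := (hm.and self_mem_nhdsWithin).exists
  have hζm : ∀ᶠ t in 𝓝 (0 : ℝ≥0), ζ t < m := by
    refine hζ.eventually (gt_mem_nhds ?_)
    rw [hζ0]
    exact hm0
  obtain ⟨c, hc0, hc⟩ := (nhds_bot_basis (α := ℝ≥0)).eventually_iff.1 hζm
  refine iInf_badRegrets_pos_iff.2 ⟨c, NNReal.coe_pos.2 hc0, fun u hu => ?_⟩
  by_contra! hlt
  have h1 : ζ (condRegret L u p).toNNReal < m := hc ((Real.toNNReal_lt_iff_lt_coe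
    (condRegret_nonneg hneL u)).2 hlt)
  have h2 := (hpoint u).trans_lt (ENNReal.coe_lt_coe.2 h1)
  rw [← ENNReal.ofReal_coe_nnreal, ENNReal.ofReal_lt_ofReal_iff (by exact_mod_cast hm0)] at h2
  exact lt_asymm h2 (hm _ hu)

end Transfer

end PolyhedralSurrogate

theorem mainTheorem3 {X Y R : Type*} [MeasurableSpace X] [Nonempty X]
    [Fintype Y] [Nonempty Y] [MeasurableSpace Y] [DiscreteMeasurableSpace Y]
    [Finite R] [MeasurableSpace R] [DiscreteMeasurableSpace R] {d : ℕ}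
    (ℓ : R → Y → ℝ≥0) (L : (Fin d → ℝ) → Y → ℝ≥0) (ψ : (Fin d → ℝ) → R)
    (hL : PolyhedralSurrogate.IsPolyhedralLoss L) :
    -- the maximum that defines `H_L` is over a nonempty finite set, and it is finite
    ((PolyhedralSurrogate.levelVertices L).Nonempty ∧
      (PolyhedralSurrogate.levelVertices L).Finite ∧
      PolyhedralSurrogate.hoffman L < ∞) ∧
    -- the separation of a calibrated link is positive
    (PolyhedralSurrogate.Calibrated L ψ ℓ → 0 < PolyhedralSurrogate.linkSeparation L ψ ℓ) ∧
    -- consistency implies calibration and the explicit linear regret transfer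
    (PolyhedralSurrogate.Consistent X L ψ ℓ →
      PolyhedralSurrogate.Calibrated L ψ ℓ ∧
      ∀ (D : Measure (X × Y)), IsProbabilityMeasure D →
        ∀ h : X → (Fin d → ℝ), Measurable h → Measurable (ψ ∘ h) →
          PolyhedralSurrogate.regret ℓ (ψ ∘ h) D ≤
            ENNReal.ofReal (PolyhedralSurrogate.lossRange ℓ) * PolyhedralSurrogate.hoffman L /
              PolyhedralSurrogate.linkSeparation L ψ ℓ *
              PolyhedralSurrogate.regret L h D) := by
  refine ⟨⟨PolyhedralSurrogate.levelVertices_nonempty hL,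
    PolyhedralSurrogate.finite_levelVertices hL, PolyhedralSurrogate.hoffman_lt_top hL⟩,
    fun hc => hc.linkSeparation_pos hL, fun hcons => ?_⟩
  have hc := hcons.calibrated hL
  exact ⟨hc, fun D _ h hh hψ => hc.regret_le hL D hh hψ⟩
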